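/- Let $N\ge 1$ be an integer and let $x\in(0,1)\setminus\mathbb Q$ have the $N$-continued fraction expansion $$x=[d_1,d_2,d_3,\dots]_N=\cfrac{N}{d_1+\cfrac{N}{d_2+\cdots}},\qquad d_n\in\mathbb N,\ d_n\ge N\ \text{ for all } n\ge 1 .$$ For $d\ge N$ let $\hat\sigma_d$ be the substitution on $\{0,1\}^*$ given by $0\mapsto 0^d1$, $1\mapsto 0^N$. Then the limit $$\hat\omega(x,N)=\lim_{n\to\infty}\hat\sigma_{d_1}\hat\sigma_{d_2}\cdots\hat\sigma_{d_n}(0)$$ (the dual $N$-continued-fraction sequence of $x$) exists, and there is a Cantor real base $B$ such that $\hat\omega(x,N)$ is the faithful coding of the $B$-integers. Here a Cantor real base is a sequence $B=(\beta_n)_{n\in\mathbb Z}$ of real numbers $\beta_n>1$ with $\prod_{n\ge1}\beta_n=\prod_{n\ge1}\beta_{-n}=+\infty$. A $B$-representation of a real number $y\ge 0$ is a sequence $(a_n)_{n\in\mathbb Z}$ of non-negative integers with $a_n=0$ for all sufficiently large $n$ and $$y=\sum_{n\ge 0}a_n\beta_{n-1}\cdots\beta_0+\sum_{n\ge 1}\frac{a_{-n}}{\beta_{-1}\cdots\beta_{-n}}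 .$$ The $B$-expansion of $y$ is its greatest $B$-representation in the radix order, where $(a_n)<(b_n)$ if there is an $i$ with $a_j=b_j$ for all $j>i$ and $a_i<b_i$. A $B$-integer is a real number $y\ge0$ whose $B$-expansion satisfies $a_n=0$ for all $n<0$. An infinite word $u_0u_1u_2\cdots$ is the faithful coding of the $B$-integers (unique up to renaming letters) if, for the increasing enumeration $z_0<z_1<z_2<\cdots$ of all $B$-integers, one has $u_i=u_j$ if and only if $z_{i+1}-z_i=z_{j+1}-z_j$, for all $i,j\ge0$. -/

import Mathlib

open Filter Topology

/-! ### Cantor real bases and their integers -/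

/-- A Cantor real base `(β_n)_{n ∈ ℤ}`: all `β_n > 1`, and the products `∏_{n ≥ 1} β_n` and
`∏_{n ≥ 1} β_{-n}` are infinite. -/
structure CantorRealBase where
  β : ℤ → ℝ
  one_lt : ∀ n, 1 < β n
  prod_right : Tendsto (fun n : ℕ => ∏ i ∈ Finset.range n, β ((i : ℤ) + 1)) atTop atTop
  prod_left : Tendsto (fun n : ℕ => ∏ i ∈ Finset.range n, β (-((i : ℤ) + 1))) atTop atTop

namespace CantorRealBase

/-- The value of position `n`: it is `β_{n-1} ⋯ β_0` for `n ≥ 0`, and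
`1 / (β_{-1} ⋯ β_{-m})` for `n = -m < 0`. -/
noncomputable def place (B : CantorRealBase) : ℤ → ℝ
  | Int.ofNat n => ∏ i ∈ Finset.range n, B.β (i : ℤ)
  | Int.negSucc n => (∏ i ∈ Finset.range (n + 1), B.β (-((i : ℤ) + 1)))⁻¹

/-- The bi-infinite digit sequence `a` has a left tail of zeros and evaluates to `x`. -/
def IsRepresentation (B : CantorRealBase) (a : ℤ → ℕ) (x : ℝ) : Prop :=
  (∃ M : ℤ, ∀ n, M ≤ n → a n = 0) ∧ HasSum (fun n : ℤ => (a n : ℝ) * B.place n) x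

/-- The (strict) radix order on bi-infinite digit sequences. -/
def RadixLT (a b : ℤ → ℕ) : Prop :=
  ∃ i : ℤ, (∀ j, i < j → a j = b j) ∧ a i < b i

/-- `a` is the `B`-expansion of `x`: its largest `B`-representation in the radix order. -/
def IsExpansion (B : CantorRealBase) (a : ℤ → ℕ) (x : ℝ) : Prop :=
  B.IsRepresentation a x ∧ ∀ b, B.IsRepresentation b x → b = a ∨ RadixLT b a

/-- `x` is a `B`-integer: its `B`-expansion has no fractional part. -/
def IsInteger (B : CantorRealBase) (x : ℝ) : Prop :=
  ∃ a : ℤ → ℕ, B.IsExpansion a x ∧ ∀ n, n < 0 → a n = 0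

/-- `u` is a faithful coding of the `B`-integers: for the increasing enumeration
`z_0 < z_1 < ⋯` of all `B`-integers, the letter `u_i` encodes the distance `z_{i+1} - z_i`,
equal distances being encoded by equal letters and distinct distances by distinct letters. -/
def IsFaithfulCoding (B : CantorRealBase) {α : Type*} (u : ℕ → α) : Prop :=
  ∃ z : ℕ → ℝ, StrictMono z ∧ Set.range z = {x | B.IsInteger x} ∧
    ∀ i j, u i = u j ↔ z (i + 1) - z i = z (j + 1) - z j

end CantorRealBase

/-! ### `N`-continued fractions and the dual sequences

Digit sequences are indexed from zero: `d 0, d 1, …` stand for `d_1, d_2, …`. -/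

/-- The finite `N`-continued fraction `N / (d_1 + N / (d_2 + ⋯ + N / d_n))`. -/
noncomputable def ncfConvergent (N : ℕ) : (ℕ → ℕ) → ℕ → ℝ
  | _, 0 => 0
  | d, n + 1 => (N : ℝ) / ((d 0 : ℝ) + ncfConvergent N (fun i => d (i + 1)) n)

/-- `x = [d_1, d_2, d_3, …]_N` : the digits are all at least `N` and the finite `N`-continued
fractions converge to `x`. -/
def IsNCFExpansion (N : ℕ) (d : ℕ → ℕ) (x : ℝ) : Prop :=
  (∀ n, N ≤ d n) ∧ Tendsto (ncfConvergent N d) atTop (𝓝 x)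

/-- The substitution `0 ↦ 0^d 1`, `1 ↦ 0^N`. -/
def dualSubst (N d : ℕ) : Fin 2 → List (Fin 2) :=
  ![List.replicate d 0 ++ [1], List.replicate N 0]

/-- The finite word obtained from `0` by applying the composition of the substitutions with
parameters `d_1, d_2, …, d_n` (the one with parameter `d_1` being applied last). -/
def dualWord (N : ℕ) : (ℕ → ℕ) → ℕ → List (Fin 2)
  | _, 0 => [0]
  | d, n + 1 => (dualWord N (fun i => d (i + 1)) n).flatMap (dualSubst N (d 0))

/-- The infinite word `u` is the limit of the finite words `w n` (letter by letter). -/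
def IsWordLimit {α : Type*} (w : ℕ → List α) (u : ℕ → α) : Prop :=
  ∀ i, ∀ᶠ n in atTop, (w n)[i]? = some (u i)

/-- `ω` is the dual `N`-continued fraction sequence of the digit sequence `d`. -/
def IsDualNCFSequence (N : ℕ) (d : ℕ → ℕ) (ω : ℕ → Fin 2) : Prop :=
  IsWordLimit (dualWord N d) ω

/-! ### Irrational numbers in `(0,1)` have an `N`-continued fraction -/

theorem ncfConvergent_mem (N : ℕ) (hN : 1 ≤ N) (n : ℕ) :
    ∀ d : ℕ → ℕ, (∀ i, N ≤ d i) → 0 ≤ ncfConvergent N d n ∧ ncfConvergent N d n ≤ 1 := by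
  have hN' : (1 : ℝ) ≤ N := by exact_mod_cast hN
  induction n with
  | zero => intro d _; simp [ncfConvergent]
  | succ n ih =>
    intro d hd
    obtain ⟨h0, -⟩ := ih (fun i => d (i + 1)) (fun i => hd _)
    have hd0 : (N : ℝ) ≤ d 0 := by exact_mod_cast hd 0
    simp only [ncfConvergent]
    exact ⟨by positivity, by rw [div_le_one (by linarith)]; linarith⟩

/-- The digits produced by the map `x ↦ N / x - ⌊N / x⌋` form an expansion. -/
theorem exists_isNCFExpansion (N : ℕ) (hN : 1 ≤ N) (x : ℝ) (hx : Irrational x)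
    (h0 : 0 < x) (h1 : x < 1) : ∃ d, IsNCFExpansion N d x := by
  have hN' : (1 : ℝ) ≤ N := by exact_mod_cast hN
  set T : ℝ → ℝ := fun y => Int.fract ((N : ℝ) / y) with hT
  set r : ℕ → ℝ := fun n => T^[n] x with hr
  have hirr : ∀ n, Irrational (r n) ∧ 0 < r n ∧ r n < 1 := by
    intro n
    induction n with
    | zero => exact ⟨hx, h0, h1⟩
    | succ n ih =>
      have e : r (n + 1) = Int.fract ((N : ℝ) / r n) := Function.iterate_succ_apply' T n x
      have hi : Irrational (r (n + 1)) := by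
        rw [e, Int.fract]
        exact (ih.1.natCast_div (by omega)).sub_intCast _
      refine ⟨hi, lt_of_le_of_ne (e ▸ Int.fract_nonneg _) (fun h => hi.ne_zero h.symm), ?_⟩
      rw [e]; exact Int.fract_lt_one _
  set d : ℕ → ℕ := fun n => ⌊(N : ℝ) / r n⌋₊ with hd
  have hdN : ∀ n, N ≤ d n := by
    intro n
    apply Nat.le_floor
    rw [le_div_iff₀ (hirr n).2.1]
    nlinarith [(hirr n).2.2]
  have hstep : ∀ n, r n = (N : ℝ) / ((d n : ℝ) + r (n + 1)) := by
    intro n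
    have e : r (n + 1) = Int.fract ((N : ℝ) / r n) := Function.iterate_succ_apply' T n x
    have hp := (hirr n).2.1
    have e2 : (d n : ℝ) + r (n + 1) = (N : ℝ) / r n := by
      have : 0 ≤ (N : ℝ) / r n := by positivity
      rw [e, hd]
      simp only
      rw [natCast_floor_eq_intCast_floor this]
      exact Int.floor_add_fract _
    rw [e2]
    field_simp
  have hone : ∀ (a s t : ℝ), (N : ℝ) ≤ a → 0 ≤ s → 0 ≤ t →
      |(N : ℝ) / (a + s) - N / (a + t)| ≤ |s - t| := by
    intro a s t ha hs ht
    have p1 : 0 < a + s := by linarith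
    have p2 : 0 < a + t := by linarith
    have : (N : ℝ) / (a + s) - N / (a + t) = N * (t - s) / ((a + s) * (a + t)) := by
      field_simp; ring
    rw [this, abs_div, abs_mul, abs_of_pos (mul_pos p1 p2), abs_sub_comm t s,
      abs_of_pos (by linarith : (0 : ℝ) < N), div_le_iff₀ (mul_pos p1 p2), mul_comm]
    gcongr
    nlinarith
  have htwo : ∀ (a b s t : ℝ), (N : ℝ) ≤ a → (N : ℝ) ≤ b → 0 ≤ s → 0 ≤ t →
      |(N : ℝ) / (a + N / (b + s)) - N / (a + N / (b + t))| ≤ |s - t| * (1 / 4) := by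
    intro a b s t ha hb hs ht
    have p1 : 0 < b + s := by linarith
    have p2 : 0 < b + t := by linarith
    have pa : 0 < a := by linarith
    have q1 : (N : ℝ) + N ≤ a * (b + s) + N := by nlinarith
    have q2 : (N : ℝ) + N ≤ a * (b + t) + N := by nlinarith
    have q1p : 0 < a * (b + s) + N := by linarith
    have q2p : 0 < a * (b + t) + N := by linarith
    have : (N : ℝ) / (a + N / (b + s)) - N / (a + N / (b + t))
        = (N ^ 2 * (s - t)) / ((a * (b + s) + N) * (a * (b + t) + N)) := by
      field_simp; ring
    rw [this, abs_div, abs_mul, abs_of_pos (mul_pos q1p q2p),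
      abs_of_pos (by positivity : (0 : ℝ) < (N : ℝ) ^ 2), div_le_iff₀ (mul_pos q1p q2p)]
    have : (N : ℝ) ^ 2 ≤ 1 / 4 * ((a * (b + s) + N) * (a * (b + t) + N)) := by nlinarith
    nlinarith [abs_nonneg (s - t)]
  have hbd : ∀ n m, |ncfConvergent N (fun i => d (i + m)) n - r m| ≤ (1 / 2 : ℝ) ^ n * 2 := by
    intro n
    induction n using Nat.twoStepInduction with
    | zero =>
      intro m
      have := hirr m
      simp only [ncfConvergent, zero_sub, abs_neg, abs_of_pos this.2.1]
      linarith
    | one =>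
      intro m
      have h := hone (d m) 0 (r (m + 1)) (by exact_mod_cast hdN m) le_rfl (hirr _).2.1.le
      rw [← hstep m] at h
      simp only [zero_sub, abs_neg, abs_of_pos (hirr (m + 1)).2.1] at h
      simp only [ncfConvergent, zero_add]
      linarith [(hirr (m + 1)).2.2]
    | more n ih _ =>
      intro m
      have hc := (ncfConvergent_mem N hN n (fun i => d (i + (m + 2))) (fun i => hdN _)).1
      have h := htwo (d m) (d (m + 1)) _ (r (m + 2)) (by exact_mod_cast hdN m)
        (by exact_mod_cast hdN (m + 1)) hc (hirr _).2.1.le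
      rw [← hstep (m + 1), ← hstep m] at h
      have e : ncfConvergent N (fun i => d (i + m)) (n + 2)
          = N / (d m + N / (d (m + 1) + ncfConvergent N (fun i => d (i + (m + 2))) n)) := by
        simp only [ncfConvergent, zero_add, add_assoc]
        norm_num [add_comm, add_left_comm]
      rw [e]
      refine h.trans ?_
      have := ih (m + 2)
      rw [pow_add]
      nlinarith
  refine ⟨d, hdN, ?_⟩
  rw [tendsto_iff_dist_tendsto_zero]
  refine squeeze_zero (fun _ => dist_nonneg) (fun n => ?_)
    (g := fun n : ℕ => (1 / 2 : ℝ) ^ n * 2)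
    (by simpa using (tendsto_pow_atTop_nhds_zero_of_lt_one (r := (1 / 2 : ℝ)) (by norm_num)
      (by norm_num)).mul_const 2)
  rw [Real.dist_eq]
  exact hbd n 0

/-! Write w_n for `dualWord N d n` and p_n for `placeSeq N d n`, with digits indexed from zero.
Composing the substitutions gives w_{n+2} = w_{n+1}^{d_{n+1}} w_n^N (`dualWord_add_two`), so each
w_n is a prefix of the next and the limit ω exists. Give the letter 0 length 1 and the letter 1
length N/(N+1). Then w_n has length p_{n+1}, which is taken as the value of position n, so ω becomes
a tiling of the half-line.

The left endpoints of the tiles are the sums ∑ a_i p_{i+1} over finitely supported admissible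
digits: a_n ≤ d_n, and a_n < N whenever a_{n+1} = d_{n+1}. The digits record which copy of which
block contains the tile (`IsAdmissible.sum_mem_prefixSums`,
`exists_isAdmissible_of_mem_prefixSums`).

The same sums are the B-integers (`dualBase_isInteger_iff`): admissible digits are greedy, and any
violation allows a carry to a larger representation. The two tile lengths differ, so the coding is
faithful. -/

/-! ### The place values and the base -/

/-- The place values, shifted by one: `placeSeq N d (n + 1)` is the value of position `n`. -/
noncomputable def placeSeq (N : ℕ) (d : ℕ → ℕ) : ℕ → ℝ
  -- The value of position -1. It satisfies 1 = N p_0 + p_0, so d_0 + 1 = p_2 + p_0: an overflow in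
  -- position 0 can be carried.
  | 0 => 1 / ((N : ℝ) + 1)
  | 1 => 1
  | n + 2 => d n * placeSeq N d (n + 1) + N * placeSeq N d n

theorem placeSeq_add_two (N : ℕ) (d : ℕ → ℕ) (n : ℕ) :
    placeSeq N d (n + 2) = d n * placeSeq N d (n + 1) + N * placeSeq N d n := rfl

theorem placeSeq_pos (N : ℕ) (d : ℕ → ℕ) (hd : ∀ i, 1 ≤ d i) (n : ℕ) : 0 < placeSeq N d n := by
  induction n using Nat.twoStepInduction with
  | zero => simp only [placeSeq]; positivity
  | one => simp [placeSeq]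
  | more n h0 h1 =>
    rw [placeSeq_add_two]
    have : (1 : ℝ) ≤ d n := by exact_mod_cast hd n
    positivity

theorem placeSeq_add_le (N : ℕ) (hN : 1 ≤ N) (d : ℕ → ℕ) (hd : ∀ i, 1 ≤ d i) (n : ℕ) :
    placeSeq N d (n + 1) + placeSeq N d n ≤ placeSeq N d (n + 2) := by
  rw [placeSeq_add_two]
  have h1 : (1 : ℝ) ≤ d n := by exact_mod_cast hd n
  have h2 : (1 : ℝ) ≤ N := by exact_mod_cast hN
  have := placeSeq_pos N d hd n
  have := placeSeq_pos N d hd (n + 1)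
  nlinarith

theorem placeSeq_strictMono (N : ℕ) (hN : 1 ≤ N) (d : ℕ → ℕ) (hd : ∀ i, 1 ≤ d i) :
    StrictMono (placeSeq N d) := by
  refine strictMono_nat_of_lt_succ fun n => ?_
  cases n with
  | zero =>
    have h2 : (1 : ℝ) ≤ N := by exact_mod_cast hN
    simp only [placeSeq]
    rw [div_lt_one (by positivity)]
    linarith
  | succ n => linarith [placeSeq_add_le N hN d hd n, placeSeq_pos N d hd n]

theorem tendsto_placeSeq (N : ℕ) (hN : 1 ≤ N) (d : ℕ → ℕ) (hd : ∀ i, 1 ≤ d i) :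
    Tendsto (placeSeq N d) atTop atTop := by
  have h0 := placeSeq_pos N d hd 0
  -- Each step adds at least p_0, so growth is at least linear.
  have key : ∀ n : ℕ, (n : ℝ) * placeSeq N d 0 ≤ placeSeq N d (n + 1) := by
    intro n
    induction n with
    | zero => simpa using (placeSeq_pos N d hd 1).le
    | succ n ih =>
      have := placeSeq_add_le N hN d hd n
      have := (placeSeq_strictMono N hN d hd).monotone (Nat.zero_le n)
      push_cast
      linarith
  rw [← tendsto_add_atTop_iff_nat 1]
  exact tendsto_atTop_mono key (tendsto_natCast_atTop_atTop.atTop_mul_const h0)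

/-- The Cantor real base whose integers are coded by the dual `N`-continued fraction sequence. -/
noncomputable def dualBase (N : ℕ) (hN : 1 ≤ N) (d : ℕ → ℕ) (hd : ∀ i, 1 ≤ d i) :
    CantorRealBase where
  β
    | Int.ofNat n => placeSeq N d (n + 2) / placeSeq N d (n + 1)
    -- Only β_{-1} is dictated by p_0; repeating the constant makes the left product diverge.
    | Int.negSucc _ => (N : ℝ) + 1
  one_lt := by
    rintro (n | n)
    · exact (one_lt_div (placeSeq_pos N d hd _)).2
        (placeSeq_strictMono N hN d hd (Nat.lt_succ_self _))
    · have : (1 : ℝ) ≤ N := by exact_mod_cast hN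
      show 1 < (N : ℝ) + 1
      linarith
  prod_right := by
    have h (n : ℕ) : ∏ i ∈ Finset.range n, (placeSeq N d (i + 1 + 2) / placeSeq N d (i + 1 + 1))
        = placeSeq N d (n + 2) / placeSeq N d 2 := by
      induction n with
      | zero => simp [(placeSeq_pos N d hd 2).ne']
      | succ n ih =>
        have := placeSeq_pos N d hd 2
        have := placeSeq_pos N d hd (n + 2)
        rw [Finset.prod_range_succ, ih]
        field_simp
    refine Tendsto.congr (fun n => (h n).symm) ?_
    exact ((tendsto_add_atTop_iff_nat 2).2 (tendsto_placeSeq N hN d hd)).atTop_div_const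
      (placeSeq_pos N d hd 2)
  prod_left := by
    have h1 : (1 : ℝ) ≤ N := by exact_mod_cast hN
    have h (n : ℕ) : ((N : ℝ) + 1) ^ n = ∏ i ∈ Finset.range n,
        (match -((i : ℤ) + 1) with
          | Int.ofNat n => placeSeq N d (n + 2) / placeSeq N d (n + 1)
          | Int.negSucc _ => (N : ℝ) + 1) := by
      rw [Finset.prod_congr rfl (g := fun _ => (N : ℝ) + 1), Finset.prod_const, Finset.card_range]
      intro i _
      rw [← Int.negSucc_eq]
    exact Tendsto.congr h (tendsto_pow_atTop_atTop_of_one_lt (by linarith))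

theorem dualBase_place_natCast (N : ℕ) (hN : 1 ≤ N) (d : ℕ → ℕ) (hd : ∀ i, 1 ≤ d i) (n : ℕ) :
    (dualBase N hN d hd).place (n : ℤ) = placeSeq N d (n + 1) := by
  show ∏ i ∈ Finset.range n, (placeSeq N d (i + 2) / placeSeq N d (i + 1)) = _
  induction n with
  | zero => simp [placeSeq]
  | succ n ih =>
    have := placeSeq_pos N d hd (n + 1)
    rw [Finset.prod_range_succ, ih]
    field_simp

theorem dualBase_place_natCast_sub_one (N : ℕ) (hN : 1 ≤ N) (d : ℕ → ℕ) (hd : ∀ i, 1 ≤ d i)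
    (n : ℕ) : (dualBase N hN d hd).place ((n : ℤ) - 1) = placeSeq N d n := by
  cases n with
  | zero =>
    show (∏ i ∈ Finset.range 1, (dualBase N hN d hd).β (-((i : ℤ) + 1)))⁻¹ = 1 / ((N : ℝ) + 1)
    rw [Finset.prod_range_one, one_div]
    rfl
  | succ n =>
    rw [← dualBase_place_natCast N hN d hd]
    push_cast
    rw [add_sub_cancel_right]

theorem CantorRealBase.place_pos (B : CantorRealBase) (n : ℤ) : 0 < B.place n := by
  have h (n : ℤ) : 0 < B.β n := one_pos.trans (B.one_lt n)
  cases n with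
  | ofNat n => exact Finset.prod_pos fun i _ => h _
  | negSucc n => exact inv_pos.2 (Finset.prod_pos fun i _ => h _)

/-! ### Expansions -/

/-- A finitely supported digit sequence satisfying the greedy condition is an expansion. -/
theorem CantorRealBase.isExpansion_of_greedy (B : CantorRealBase) (a : ℤ → ℕ) (x : ℝ) (K M : ℤ)
    (hK : ∀ n, n < K → a n = 0) (hM : ∀ n, M ≤ n → a n = 0)
    (hx : x = ∑ n ∈ Finset.Ico K M, (a n : ℝ) * B.place n)
    (hg : ∀ i, ∑ n ∈ Finset.Ico K i, (a n : ℝ) * B.place n < B.place i) :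
    B.IsExpansion a x := by
  have hs (L : ℤ) (hL : M ≤ L) : HasSum (fun n : ℤ => (a n : ℝ) * B.place n)
      (∑ n ∈ Finset.Ico K L, (a n : ℝ) * B.place n) := by
    refine hasSum_sum_of_ne_finset_zero fun n hn => ?_
    rw [Finset.mem_Ico, not_and_or, not_le, not_lt] at hn
    rcases hn with hn | hn
    · simp [hK n hn]
    · simp [hM n (hL.trans hn)]
  refine ⟨⟨⟨M, hM⟩, hx ▸ hs M le_rfl⟩, ?_⟩
  rintro b ⟨⟨M', hM'⟩, hb⟩
  by_cases hab : b = a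
  · exact Or.inl hab
  right
  obtain ⟨n₀, hn₀⟩ := Function.ne_iff.1 hab
  obtain ⟨i, hi, hmax⟩ := Int.exists_greatest_of_bdd (P := fun n => b n ≠ a n)
    ⟨max M M', fun n hn => by
      by_contra! h
      exact hn ((hM' n (by omega)).trans (hM n (by omega)).symm)⟩ ⟨n₀, hn₀⟩
  have heq (j : ℤ) (hj : i < j) : b j = a j := by
    by_contra h
    exact absurd (hmax j h) (by omega)
  refine ⟨i, heq, lt_of_le_of_ne ?_ hi⟩
  -- If b exceeds a at the highest differing position i, it gains at least `B.place i` there, more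
  -- than all lower digits of a contribute by `hg`.
  by_contra! hlt
  set L := max M (max (i + 1) K)
  have hxL : x = ∑ n ∈ Finset.Ico K L, (a n : ℝ) * B.place n :=
    (hx ▸ hs M le_rfl).unique (hs L (le_max_left _ _))
  have hbL : ∑ n ∈ Finset.Ico i L, (b n : ℝ) * B.place n ≤ x :=
    sum_le_hasSum _ (fun n _ => mul_nonneg (Nat.cast_nonneg _) (B.place_pos n).le) hb
  have hsplit : ∑ n ∈ Finset.Ico K L, (a n : ℝ) * B.place n ≤
      ∑ n ∈ Finset.Ico K i, (a n : ℝ) * B.place n +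
      ∑ n ∈ Finset.Ico i L, (a n : ℝ) * B.place n := by
    rw [← Finset.sum_union]
    · refine Finset.sum_le_sum_of_subset_of_nonneg (fun n hn => ?_)
        (fun n _ _ => mul_nonneg (Nat.cast_nonneg _) (B.place_pos n).le)
      simp only [Finset.mem_union, Finset.mem_Ico] at hn ⊢
      omega
    · rw [Finset.disjoint_left]
      intro n hn hn'
      simp only [Finset.mem_Ico] at hn hn'
      omega
  have hins : Finset.Ico i L = insert i (Finset.Ico (i + 1) L) := by
    ext n
    simp only [Finset.mem_insert, Finset.mem_Ico]
    omega
  rw [hins, Finset.sum_insert (by simp)] at hbL hsplit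
  have hsame : ∑ n ∈ Finset.Ico (i + 1) L, (b n : ℝ) * B.place n =
      ∑ n ∈ Finset.Ico (i + 1) L, (a n : ℝ) * B.place n := by
    refine Finset.sum_congr rfl fun n hn => ?_
    rw [heq n (by simp only [Finset.mem_Ico] at hn; omega)]
  have h1 : (a i : ℝ) + 1 ≤ b i := by exact_mod_cast hlt
  nlinarith [hg i, B.place_pos i]

/-- An expansion cannot be increased by a local change of digits that preserves its value. -/
theorem CantorRealBase.IsExpansion.place_add_ne_zero {B : CantorRealBase} {a : ℤ → ℕ} {x : ℝ}
    (h : B.IsExpansion a x) (k c₁ c₂ c₃ : ℤ) (h₁ : 0 ≤ a (k - 1) + c₁) (h₂ : 0 ≤ a (k - 2) + c₂)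
    (h₃ : 0 ≤ a (k - 3) + c₃) :
    B.place k + c₁ * B.place (k - 1) + c₂ * B.place (k - 2) + c₃ * B.place (k - 3) ≠ 0 := by
  intro h0
  -- If the combination vanished, a + c would have the same value and non-negative digits, and its
  -- highest change would be +1 at k, so it would beat the expansion a.
  set c : ℤ → ℤ := fun n => if n = k then 1 else if n = k - 1 then c₁ else
    if n = k - 2 then c₂ else if n = k - 3 then c₃ else 0 with hc
  have hc0 : c k = 1 := by simp [hc]
  have hc1 : c (k - 1) = c₁ := by simp [hc]
  have hc2 : c (k - 2) = c₂ := by simp [hc]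
  have hc3 : c (k - 3) = c₃ := by simp [hc]
  have hcz : ∀ n, n ≠ k → n ≠ k - 1 → n ≠ k - 2 → n ≠ k - 3 → c n = 0 := by
    intro n e0 e1 e2 e3
    simp [hc, e0, e1, e2, e3]
  have hnn (n : ℤ) : 0 ≤ (a n : ℤ) + c n := by
    by_cases e0 : n = k
    · rw [e0, hc0]; positivity
    by_cases e1 : n = k - 1
    · rw [e1, hc1]; exact h₁
    by_cases e2 : n = k - 2
    · rw [e2, hc2]; exact h₂
    by_cases e3 : n = k - 3
    · rw [e3, hc3]; exact h₃
    rw [hcz n e0 e1 e2 e3]; positivity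
  set b : ℤ → ℕ := fun n => ((a n : ℤ) + c n).toNat
  have hb (n : ℤ) : (b n : ℤ) = a n + c n := Int.toNat_of_nonneg (hnn n)
  have hb' (n : ℤ) : (b n : ℝ) = a n + c n := by exact_mod_cast hb n
  have hgt (n : ℤ) (hn : k < n) : c n = 0 :=
    hcz n (by omega) (by omega) (by omega) (by omega)
  have hsum : HasSum (fun n : ℤ => (c n : ℝ) * B.place n) 0 := by
    have := hasSum_sum_of_ne_finset_zero (f := fun n : ℤ => (c n : ℝ) * B.place n)
      (s := {k, k - 1, k - 2, k - 3}) (L := SummationFilter.unconditional ℤ) (by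
        intro n hn
        simp only [Finset.mem_insert, Finset.mem_singleton, not_or] at hn
        rw [hcz n hn.1 hn.2.1 hn.2.2.1 hn.2.2.2]
        simp)
    rw [Finset.sum_insert (by simp; omega), Finset.sum_insert (by simp),
      Finset.sum_insert (by simp), Finset.sum_singleton, hc0, hc1, hc2, hc3] at this
    convert this using 1
    rw [← h0]
    push_cast
    ring
  obtain ⟨⟨⟨M, hM⟩, ha⟩, hmax⟩ := h
  have hbrep : B.IsRepresentation b x := by
    refine ⟨⟨max M (k + 1), fun n hn => ?_⟩, ?_⟩
    · have := hb n
      rw [hM n (by omega), hgt n (by omega)] at this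
      simpa using this
    · have := ha.add hsum
      rw [add_zero] at this
      simpa only [hb', add_mul] using this
  have hbk := hb k
  rw [hc0] at hbk
  rcases hmax b hbrep with e | ⟨i, hi, hlt⟩
  · rw [e] at hbk; omega
  · have hbi := hb i
    rcases lt_trichotomy i k with hik | hik | hik
    · have := hi k hik
      omega
    · subst hik; omega
    · rw [hgt i hik] at hbi; omega

/-! ### Admissible digit sequences -/

/-- The digit sequences of the integers of `dualBase N _ d _`. -/
def IsAdmissible (N : ℕ) (d a : ℕ → ℕ) : Prop :=
  ∀ n, a n ≤ d n ∧ (a (n + 1) = d (n + 1) → a n < N)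

/-- This is the greedy condition. A top digit below its maximum leaves room for one more p_{n+2}; a
maximal one leaves N p_{n+1}, which suffices because the next digit is below N. -/
theorem IsAdmissible.sum_lt {N : ℕ} (hN : 1 ≤ N) {d a : ℕ → ℕ} (hd : ∀ i, 1 ≤ d i)
    (ha : IsAdmissible N d a) (n : ℕ) :
    ∑ i ∈ Finset.range n, (a i : ℝ) * placeSeq N d (i + 1) < placeSeq N d (n + 1) := by
  have hN' : (1 : ℝ) ≤ N := by exact_mod_cast hN
  have hp := placeSeq_pos N d hd
  induction n using Nat.twoStepInduction with
  | zero => simpa using hp 1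
  | one =>
    have h1 : (a 0 : ℝ) ≤ d 0 := by exact_mod_cast (ha 0).1
    have := hp 0
    rw [Finset.sum_range_one, placeSeq_add_two]
    nlinarith [hp 1]
  | more n h0 h1 =>
    rw [Finset.sum_range_succ, placeSeq_add_two N d (n + 1)]
    have := hp (n + 1)
    have := hp (n + 2)
    rcases (ha (n + 1)).1.lt_or_eq with h | h
    · have h : (a (n + 1) : ℝ) + 1 ≤ d (n + 1) := by exact_mod_cast h
      nlinarith
    · have h2 : (a n : ℝ) + 1 ≤ N := by exact_mod_cast (ha n).2 h
      rw [Finset.sum_range_succ, h]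
      nlinarith

theorem dualBase_isInteger_iff (N : ℕ) (hN : 1 ≤ N) (d : ℕ → ℕ) (hd : ∀ i, 1 ≤ d i)
    (hdN : ∀ i, N ≤ d i) (x : ℝ) :
    (dualBase N hN d hd).IsInteger x ↔ ∃ (a : ℕ → ℕ) (n : ℕ), IsAdmissible N d a ∧
      (∀ i, n ≤ i → a i = 0) ∧ x = ∑ i ∈ Finset.range n, (a i : ℝ) * placeSeq N d (i + 1) := by
  set B := dualBase N hN d hd
  have hpl (n : ℕ) : B.place n = placeSeq N d (n + 1) := dualBase_place_natCast N hN d hd n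
  have hpl' (n : ℕ) : B.place ((n : ℤ) - 1) = placeSeq N d n :=
    dualBase_place_natCast_sub_one N hN d hd n
  have hIco (a : ℤ → ℕ) (n : ℕ) : ∑ i ∈ Finset.Ico (0 : ℤ) n, (a i : ℝ) * B.place i =
      ∑ i ∈ Finset.range n, (a i : ℝ) * placeSeq N d (i + 1) := by
    induction n with
    | zero => simp
    | succ n ih =>
      rw [Finset.sum_range_succ, ← ih, ← hpl]
      have : Finset.Ico (0 : ℤ) ((n + 1 : ℕ) : ℤ) = insert (n : ℤ) (Finset.Ico (0 : ℤ) n) := by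
        ext i
        simp only [Finset.mem_insert, Finset.mem_Ico]
        omega
      rw [this, Finset.sum_insert (by simp), add_comm]
  constructor
  · rintro ⟨a, ha, ha0⟩
    obtain ⟨⟨M, hM⟩, hsum⟩ := ha.1
    refine ⟨fun n => a n, M.toNat, fun m => ⟨?_, fun hm => ?_⟩, fun i hi => hM _ (by omega), ?_⟩
    · by_contra! hlt
      cases m with
      | zero =>
        -- Carry d_0 + 1 = p_2 + p_0, which creates a digit in position -1.
        refine ha.place_add_ne_zero 1 (-(d 0 + 1)) 1 0 ?_ (by positivity) (by positivity) ?_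
        · simp only [Nat.cast_zero] at hlt
          norm_num
          omega
        · have e1 := hpl 1
          have e0 := hpl 0
          have e2 := hpl' 0
          norm_num at e0 e1 e2 ⊢
          rw [e0, e1, e2, placeSeq_add_two]
          simp only [placeSeq]
          field_simp
          ring
      | succ m =>
        -- Two uses of the recurrence give (d_{m+1} + 1) p_{m+2} = p_{m+3} + (d_m - N) p_{m+1} + N
        -- p_m; the middle coefficient is non-negative because d_m ≥ N.
        refine ha.place_add_ne_zero (m + 2) (-(d (m + 1) + 1)) (d m - N) N ?_ ?_ (by positivity) ?_
        · rw [show (m : ℤ) + 2 - 1 = (m + 1 : ℕ) by push_cast; ring]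
          omega
        · have := hdN m
          omega
        · rw [show (m : ℤ) + 2 - 1 = (m + 1 : ℕ) by push_cast; ring,
            show (m : ℤ) + 2 - 2 = (m : ℕ) by ring,
            show (m : ℤ) + 2 - 3 = (m : ℕ) - 1 by ring,
            show (m : ℤ) + 2 = (m + 2 : ℕ) by push_cast; ring, hpl, hpl, hpl, hpl',
            placeSeq_add_two N d (m + 1), placeSeq_add_two N d m]
          push_cast
          ring
    · by_contra! hlt
      beta_reduce at hm
      -- The recurrence itself is the carry.
      refine ha.place_add_ne_zero (m + 2) (-(d (m + 1))) (-N) 0 ?_ ?_ (by positivity) ?_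
      · rw [show (m : ℤ) + 2 - 1 = (m + 1 : ℕ) by push_cast; ring]
        omega
      · rw [show (m : ℤ) + 2 - 2 = (m : ℕ) by ring]
        omega
      · rw [show (m : ℤ) + 2 - 1 = (m + 1 : ℕ) by push_cast; ring,
          show (m : ℤ) + 2 - 2 = (m : ℕ) by ring,
          show (m : ℤ) + 2 = (m + 2 : ℕ) by push_cast; ring, hpl, hpl, hpl,
          placeSeq_add_two N d (m + 1)]
        push_cast
        ring
    · rw [← hIco]
      refine hsum.unique (hasSum_sum_of_ne_finset_zero fun n hn => ?_)
      rw [Finset.mem_Ico, not_and_or, not_le, not_lt] at hn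
      rcases hn with hn | hn
      · simp [ha0 n hn]
      · simp [hM n (by omega)]
  · rintro ⟨a, n, ha, hn, hx⟩
    set A : ℤ → ℕ := fun i => if i < 0 then 0 else a i.toNat with hA
    have hAn (i : ℕ) : A i = a i := by simp [hA]
    have hA0 (i : ℤ) (hi : i < 0) : A i = 0 := by simp [hA, hi]
    refine ⟨A, B.isExpansion_of_greedy A x 0 n hA0 (fun i hi => ?_) ?_ (fun i => ?_), hA0⟩
    · lift i to ℕ using by omega
      rw [hAn]
      exact hn i (by omega)
    · rw [hIco, hx]
      simp only [hAn]
    · rcases lt_or_ge i 0 with hi | hi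
      · rw [Finset.Ico_eq_empty (by omega), Finset.sum_empty]
        exact B.place_pos i
      · lift i to ℕ using hi
        rw [hIco, hpl]
        simp only [hAn]
        exact ha.sum_lt hN hd i

/-! ### The dual words -/

/-- The definition peels off the outermost substitution while the identity concerns the innermost
ones, so the induction shifts d. -/
theorem dualWord_add_two (N : ℕ) (n : ℕ) : ∀ d : ℕ → ℕ, dualWord N d (n + 2) =
    (List.replicate (d (n + 1)) (dualWord N d (n + 1))).flatten ++
      (List.replicate N (dualWord N d n)).flatten := by
  have hrep (w : List (Fin 2)) (f : Fin 2 → List (Fin 2)) (k : ℕ) :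
      (List.replicate k w).flatten.flatMap f = (List.replicate k (w.flatMap f)).flatten := by
    induction k with
    | zero => simp
    | succ k ih => simp [List.replicate_succ, ih]
  induction n with
  | zero =>
    intro d
    simp [dualWord, dualSubst, List.flatMap_append, List.flatMap_replicate]
  | succ n ih =>
    intro d
    show (dualWord N (fun i => d (i + 1)) (n + 2)).flatMap (dualSubst N (d 0)) = _
    rw [ih, List.flatMap_append, hrep, hrep]
    rfl

theorem dualWord_one (N : ℕ) (d : ℕ → ℕ) :
    dualWord N d 1 = List.replicate (d 0) 0 ++ [1] := by
  simp [dualWord, dualSubst]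

theorem dualWord_prefix_succ (N : ℕ) (d : ℕ → ℕ) (hd : ∀ i, 1 ≤ d i) (n : ℕ) :
    dualWord N d n <+: dualWord N d (n + 1) := by
  cases n with
  | zero =>
    rw [dualWord_one]
    obtain ⟨k, hk⟩ := Nat.exists_eq_add_of_le' (hd 0)
    rw [hk, List.replicate_succ]
    exact ⟨_, rfl⟩
  | succ n =>
    rw [dualWord_add_two]
    obtain ⟨k, hk⟩ := Nat.exists_eq_add_of_le' (hd (n + 1))
    rw [hk, List.replicate_succ, List.flatten_cons, List.append_assoc]
    exact ⟨_, rfl⟩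

theorem dualWord_prefix (N : ℕ) (d : ℕ → ℕ) (hd : ∀ i, 1 ≤ d i) {m n : ℕ} (hmn : m ≤ n) :
    dualWord N d m <+: dualWord N d n := by
  induction n, hmn using Nat.le_induction with
  | base => exact List.prefix_rfl
  | succ n _ ih => exact ih.trans (dualWord_prefix_succ N d hd n)

theorem lt_length_dualWord (N : ℕ) (hN : 1 ≤ N) (d : ℕ → ℕ) (hd : ∀ i, 1 ≤ d i) (n : ℕ) :
    n < (dualWord N d n).length := by
  induction n using Nat.twoStepInduction with
  | zero => simp [dualWord]
  | one => rw [dualWord_one]; simpa using Nat.pos_of_ne_zero (Nat.one_le_iff_ne_zero.1 (hd 0))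
  | more n h0 h1 =>
    rw [dualWord_add_two]
    simp only [List.length_append, List.length_flatten, List.map_replicate, List.sum_replicate,
      smul_eq_mul]
    nlinarith [hd (n + 1)]

/-! ### Tile endpoints and admissible digit sums -/

/-- The lengths of the proper prefixes of a word whose letters have lengths given by `wt`. -/
def prefixSums {α : Type*} (wt : α → ℝ) (w : List α) : Set ℝ :=
  {x | ∃ k < w.length, x = ((w.take k).map wt).sum}

theorem mem_prefixSums_append {α : Type*} (wt : α → ℝ) (u v : List α) (x : ℝ) :
    x ∈ prefixSums wt (u ++ v) ↔
      x ∈ prefixSums wt u ∨ ∃ y ∈ prefixSums wt v, x = (u.map wt).sum + y := by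
  constructor
  · rintro ⟨k, hk, rfl⟩
    rcases lt_or_ge k u.length with h | h
    · exact Or.inl ⟨k, h, by rw [List.take_append_of_le_length h.le]⟩
    · refine Or.inr ⟨_, ⟨k - u.length, by rw [List.length_append] at hk; omega, rfl⟩, ?_⟩
      rw [List.take_append, List.take_of_length_le h, List.map_append, List.sum_append]
  · rintro (⟨k, hk, rfl⟩ | ⟨_, ⟨k, hk, rfl⟩, rfl⟩)
    · exact ⟨k, by rw [List.length_append]; omega, by rw [List.take_append_of_le_length hk.le]⟩
    · refine ⟨u.length + k, by rw [List.length_append]; omega, ?_⟩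
      rw [List.take_length_add_append, List.map_append, List.sum_append]

theorem sum_map_flatten_replicate {α : Type*} (wt : α → ℝ) (w : List α) (n : ℕ) :
    (((List.replicate n w).flatten).map wt).sum = n * (w.map wt).sum := by
  induction n with
  | zero => simp
  | succ n ih =>
    rw [List.replicate_succ, List.flatten_cons, List.map_append, List.sum_append, ih]
    push_cast
    ring

theorem mem_prefixSums_flatten_replicate {α : Type*} (wt : α → ℝ) (w : List α) (n : ℕ) (x : ℝ) :
    x ∈ prefixSums wt (List.replicate n w).flatten ↔
      ∃ k < n, ∃ y ∈ prefixSums wt w, x = k * (w.map wt).sum + y := by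
  induction n with
  | zero => simp [prefixSums]
  | succ n ih =>
    rw [List.replicate_succ', List.flatten_append, mem_prefixSums_append, ih,
      sum_map_flatten_replicate, List.flatten_singleton]
    constructor
    · rintro (⟨k, hk, h⟩ | h)
      · exact ⟨k, by omega, h⟩
      · exact ⟨n, by omega, h⟩
    · rintro ⟨k, hk, h⟩
      rcases Nat.lt_succ_iff_lt_or_eq.1 hk with hk | rfl
      · exact Or.inl ⟨k, hk, h⟩
      · exact Or.inr h

/-- The distances between consecutive integers coded by the two letters. -/
noncomputable def letterLength (N : ℕ) : Fin 2 → ℝ := ![1, N / ((N : ℝ) + 1)]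

theorem letterLength_pos (N : ℕ) (hN : 1 ≤ N) (i : Fin 2) : 0 < letterLength N i := by
  have : (1 : ℝ) ≤ N := by exact_mod_cast hN
  fin_cases i
  · simp [letterLength]
  · show 0 < (N : ℝ) / (N + 1)
    positivity

theorem letterLength_injective (N : ℕ) : Function.Injective (letterLength N) := by
  have h : (N : ℝ) / (N + 1) ≠ 1 := by
    have : (0 : ℝ) < (N : ℝ) + 1 := by positivity
    rw [Ne, div_eq_one_iff_eq this.ne']
    linarith
  intro i j hij
  fin_cases i <;> fin_cases j
  · rfl
  · exact absurd hij.symm h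
  · exact absurd hij h
  · rfl

theorem sum_letterLength_dualWord (N : ℕ) (d : ℕ → ℕ) (n : ℕ) :
    ((dualWord N d n).map (letterLength N)).sum = placeSeq N d (n + 1) := by
  induction n using Nat.twoStepInduction with
  | zero => simp [dualWord, letterLength, placeSeq]
  | one =>
    rw [dualWord_one]
    simp [letterLength, placeSeq, div_eq_mul_inv]
  | more n h0 h1 =>
    rw [dualWord_add_two, List.map_append, List.sum_append, sum_map_flatten_replicate,
      sum_map_flatten_replicate, h0, h1, placeSeq_add_two N d (n + 1)]

theorem mem_prefixSums_dualWord_add_two (N : ℕ) (d : ℕ → ℕ) (n : ℕ) (x : ℝ) :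
    x ∈ prefixSums (letterLength N) (dualWord N d (n + 2)) ↔
      (∃ k < d (n + 1), ∃ y ∈ prefixSums (letterLength N) (dualWord N d (n + 1)),
        x = k * placeSeq N d (n + 2) + y) ∨
      ∃ k < N, ∃ y ∈ prefixSums (letterLength N) (dualWord N d n),
        x = d (n + 1) * placeSeq N d (n + 2) + (k * placeSeq N d (n + 1) + y) := by
  rw [dualWord_add_two, mem_prefixSums_append]
  simp only [mem_prefixSums_flatten_replicate, sum_map_flatten_replicate,
    sum_letterLength_dualWord]
  constructor
  · rintro (h | ⟨_, ⟨k, hk, y, hy, rfl⟩, rfl⟩)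
    · exact Or.inl h
    · exact Or.inr ⟨k, hk, y, hy, rfl⟩
  · rintro (h | ⟨k, hk, y, hy, rfl⟩)
    · exact Or.inl h
    · exact Or.inr ⟨_, ⟨k, hk, y, hy, rfl⟩, rfl⟩

theorem mem_prefixSums_dualWord_one (N : ℕ) (d : ℕ → ℕ) (x : ℝ) :
    x ∈ prefixSums (letterLength N) (dualWord N d 1) ↔ ∃ k ≤ d 0, x = (k : ℝ) := by
  have h (k : ℕ) (hk : k ≤ d 0) :
      (((List.replicate (d 0) (0 : Fin 2) ++ [1]).take k).map (letterLength N)).sum = (k : ℝ) := by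
    rw [List.take_append_of_le_length (by simpa using hk), List.take_replicate, min_eq_left hk]
    simp [letterLength]
  rw [dualWord_one]
  constructor
  · rintro ⟨k, hk, rfl⟩
    have hk : k ≤ d 0 := by simpa [Nat.lt_succ_iff] using hk
    exact ⟨k, hk, h k hk⟩
  · rintro ⟨k, hk, rfl⟩
    exact ⟨k, by simpa [Nat.lt_succ_iff] using hk, (h k hk).symm⟩

theorem zero_mem_prefixSums {α : Type*} (wt : α → ℝ) (a : α) (w : List α) :
    0 ∈ prefixSums wt (a :: w) := ⟨0, by simp, by simp⟩

theorem IsAdmissible.sum_mem_prefixSums {N : ℕ} {d a : ℕ → ℕ} (ha : IsAdmissible N d a) (n : ℕ) :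
    ∑ i ∈ Finset.range n, (a i : ℝ) * placeSeq N d (i + 1) ∈
      prefixSums (letterLength N) (dualWord N d n) := by
  induction n using Nat.twoStepInduction with
  | zero => exact zero_mem_prefixSums _ _ _
  | one =>
    rw [mem_prefixSums_dualWord_one]
    exact ⟨a 0, (ha 0).1, by simp [placeSeq]⟩
  | more n h0 h1 =>
    rw [mem_prefixSums_dualWord_add_two]
    rcases (ha (n + 1)).1.lt_or_eq with h | h
    · exact Or.inl ⟨_, h, _, h1, by rw [Finset.sum_range_succ, add_comm]⟩
    · refine Or.inr ⟨_, (ha n).2 h, _, h0, ?_⟩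
      rw [Finset.sum_range_succ, Finset.sum_range_succ, h]
      ring

theorem exists_isAdmissible_of_mem_prefixSums (N : ℕ) (hN : 1 ≤ N) (d : ℕ → ℕ)
    (hdN : ∀ i, N ≤ d i) (n : ℕ) :
    ∀ x ∈ prefixSums (letterLength N) (dualWord N d n), ∃ a : ℕ → ℕ, IsAdmissible N d a ∧
      (∀ i, n ≤ i → a i = 0) ∧ x = ∑ i ∈ Finset.range n, (a i : ℝ) * placeSeq N d (i + 1) := by
  have hsum (a : ℕ → ℕ) (n k : ℕ) :
      ∑ i ∈ Finset.range n, (Function.update a n k i : ℝ) * placeSeq N d (i + 1) =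
      ∑ i ∈ Finset.range n, (a i : ℝ) * placeSeq N d (i + 1) := by
    refine Finset.sum_congr rfl fun i hi => ?_
    rw [Function.update_of_ne (Finset.mem_range.1 hi).ne]
  -- Placing a new top digit k at n tests only the digit just below: position n + 1 holds 0, which
  -- is not maximal since d ≥ N ≥ 1.
  have hupd (a : ℕ → ℕ) (n k : ℕ) (ha : IsAdmissible N d a) (hz : ∀ i, n ≤ i → a i = 0)
      (hk : k ≤ d n) (hk' : ∀ m, n = m + 1 → k = d n → a m < N) :
      IsAdmissible N d (Function.update a n k) ∧
        ∀ i, n + 1 ≤ i → Function.update a n k i = 0 := by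
    refine ⟨fun m => ⟨?_, fun hm => ?_⟩, fun i hi => ?_⟩
    · rcases eq_or_ne m n with rfl | h
      · rwa [Function.update_self]
      · rw [Function.update_of_ne h]; exact (ha m).1
    · rcases eq_or_ne (m + 1) n with rfl | h
      · rw [Function.update_self] at hm
        rw [Function.update_of_ne (by omega)]
        exact hk' m rfl hm
      · rw [Function.update_of_ne h] at hm
        rcases eq_or_ne m n with rfl | h'
        · have := hz (m + 1) (by omega)
          have := hdN (m + 1)
          omega
        · rw [Function.update_of_ne h']; exact (ha m).2 hm
    · rw [Function.update_of_ne (by omega)]; exact hz i (by omega)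
  have hzero : IsAdmissible N d 0 := fun n => ⟨Nat.zero_le _, fun _ => hN⟩
  induction n using Nat.twoStepInduction with
  | zero =>
    rintro x ⟨k, hk, rfl⟩
    have : k = 0 := by simpa [dualWord] using hk
    exact ⟨0, hzero, fun _ _ => rfl, by simp [this]⟩
  | one =>
    intro x hx
    obtain ⟨k, hk, rfl⟩ := (mem_prefixSums_dualWord_one N d x).1 hx
    obtain ⟨h1, h2⟩ := hupd 0 0 k hzero (fun _ _ => rfl) hk (by simp)
    exact ⟨_, h1, h2, by simp [placeSeq]⟩
  | more n h0 h1 =>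
    intro x hx
    rcases (mem_prefixSums_dualWord_add_two N d n x).1 hx with
      ⟨k, hk, y, hy, rfl⟩ | ⟨k, hk, y, hy, rfl⟩
    · obtain ⟨a, ha, hz, rfl⟩ := h1 y hy
      obtain ⟨h1, h2⟩ := hupd a (n + 1) k ha hz hk.le (by omega)
      refine ⟨_, h1, h2, ?_⟩
      rw [Finset.sum_range_succ _ (n + 1), hsum, Function.update_self, add_comm]
    · obtain ⟨a, ha, hz, rfl⟩ := h0 y hy
      -- As k < N ≤ d_n, the digit at n is not maximal and puts no constraint on the one below.
      have hkd := hk.trans_le (hdN n)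
      obtain ⟨h1, h2⟩ := hupd a n k ha hz hkd.le (by omega)
      obtain ⟨h3, h4⟩ := hupd _ (n + 1) (d (n + 1)) h1 h2 le_rfl (by
        intro m hm _
        obtain rfl : n = m := by omega
        rwa [Function.update_self])
      refine ⟨_, h3, h4, ?_⟩
      rw [Finset.sum_range_succ _ (n + 1), hsum, Function.update_self, Finset.sum_range_succ, hsum,
        Function.update_self]
      ring

/-! ### The limit word and its faithful coding -/

theorem exists_isDualNCFSequence (N : ℕ) (hN : 1 ≤ N) (d : ℕ → ℕ) (hd : ∀ i, 1 ≤ d i) :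
    ∃ ω : ℕ → Fin 2, ∀ n i, i < (dualWord N d n).length → (dualWord N d n)[i]? = some (ω i) := by
  refine ⟨fun i => (dualWord N d i)[i]'(lt_length_dualWord N hN d hd i), fun n i hi => ?_⟩
  have hi' := lt_length_dualWord N hN d hd i
  rw [List.getElem?_eq_getElem hi, Option.some_inj]
  rcases le_total n i with h | h
  · exact (dualWord_prefix N d hd h).getElem hi
  · exact ((dualWord_prefix N d hd h).getElem hi').symm

theorem sum_map_take_eq_sum_range {α : Type*} (wt : α → ℝ) (w : List α) (u : ℕ → α)
    (hu : ∀ i, i < w.length → w[i]? = some (u i)) (k : ℕ) (hk : k ≤ w.length) :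
    ((w.take k).map wt).sum = ∑ i ∈ Finset.range k, wt (u i) := by
  induction k with
  | zero => simp
  | succ k ih =>
    rw [List.take_add_one, hu k (by omega), List.map_append, List.sum_append, ih (by omega),
      Finset.sum_range_succ]
    simp

theorem mainTheorem9 (N : ℕ) (hN : 1 ≤ N) (x : ℝ) (hx : Irrational x) (hx01 : x ∈ Set.Ioo (0 : ℝ) 1)
    (d : ℕ → ℕ) (hd : IsNCFExpansion N d x) :
    ∃ ω : ℕ → Fin 2, IsDualNCFSequence N d ω ∧
      ∃ B : CantorRealBase, B.IsFaithfulCoding ω := by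
  have hdN := hd.1
  have hd1 (i : ℕ) : 1 ≤ d i := hN.trans (hdN i)
  obtain ⟨ω, hω⟩ := exists_isDualNCFSequence N hN d hd1
  refine ⟨ω, fun i => ?_, dualBase N hN d hd1,
    fun k => ∑ i ∈ Finset.range k, letterLength N (ω i), ?_, ?_, fun i j => ?_⟩
  · filter_upwards [eventually_ge_atTop i] with n hn
    exact hω n i (hn.trans_lt (lt_length_dualWord N hN d hd1 n))
  · refine strictMono_nat_of_lt_succ fun n => ?_
    rw [Finset.sum_range_succ]
    exact lt_add_of_pos_right _ (letterLength_pos N hN _)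
  · ext y
    rw [Set.mem_ofPred_eq, dualBase_isInteger_iff N hN d hd1 hdN]
    constructor
    · rintro ⟨k, rfl⟩
      -- Since w_k has more than k letters, the k-th endpoint is already a proper prefix length of
      -- w_k.
      have hk := lt_length_dualWord N hN d hd1 k
      obtain ⟨a, h⟩ := exists_isAdmissible_of_mem_prefixSums N hN d hdN k _ ⟨k, hk, rfl⟩
      rw [sum_map_take_eq_sum_range _ _ _ (hω k) k hk.le] at h
      exact ⟨a, k, h⟩
    · rintro ⟨a, n, ha, -, rfl⟩
      obtain ⟨k, hk, h⟩ := ha.sum_mem_prefixSums n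
      rw [sum_map_take_eq_sum_range _ _ _ (hω n) k hk.le] at h
      exact ⟨k, h.symm⟩
  · simp only [Finset.sum_range_succ, add_sub_cancel_left]
    exact (letterLength_injective N).eq_iff.symm
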